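/- Let $p$ be a prime and $q=p^f$ with $f\ge 1$, and $f\ge 2$ if $p=2$. Let $\Gamma=(\mathcal V,\mathcal E)$ be a finite digraph without loops, $\mathcal E\subseteq \mathcal V\times\mathcal V\smallsetminus\{(x,x)\mid x\in\mathcal V\}$; an edge $(x,y)\in\mathcal E$ is called directed if $(y,x)\notin\mathcal E$, and undirected otherwise. Let $G$ be the oriented right-angled Artin pro-$p$ group associated to $\Gamma$ and $q$, i.e. the quotient of the free pro-$p$ group on $\mathcal V$ by the closed normal subgroup generated by the elements $[x,y]$ for every undirected edge $(x,y)$, and $[y,x]x^{-q}$ for every directed edge $(x,y)$, where $[x,y]=xyx^{-1}y^{-1}$. For $x\in\mathcal V$ let $x^*\in \mathrm H^1(G,\mathbb F_p)=\mathrm{Hom}_{\mathrm{cts}}(G,\mathbb F_p)$ be the continuous homomorphism with $x^*(x)=1$ and $x^*(y)=0$ for all $y\in\mathcal V$, $y\ne x$. Suppose that $\Gamma$ has three distinct vertices $u,v,w$ such that $(u,w)$ is a directed edge, $(u,v)\notin\mathcal E$ and $(v,u)\notin\mathcal E$, and one of the following holds: either $(v,w)$ is a directed edge; or $(w,v)\in\mathcal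 E$ (and possibly also $(v,w)\in\mathcal E$). Put $\alpha=u^*+v^*$ and $\beta=u^*$. Then the $q$-fold Massey product $$\langle\alpha,\underbrace{\beta,\ldots,\beta}_{q-2},\alpha\rangle\subseteq \mathrm H^2(G,\mathbb F_p)$$ is essential, i.e. it is non-empty and does not contain $0$. Here $\mathrm H^2(G,\mathbb F_p)$ is defined through continuous cochains, and for $\alpha_1,\ldots,\alpha_n\in\mathrm H^1(G,\mathbb F_p)$, $n\ge 2$, the Massey product $\langle\alpha_1,\ldots,\alpha_n\rangle$ is the set of the classes of the $2$-cocycles $\sum_{l=2}^{n}c_{1,l}\smallsmile c_{l,n+1}$, where $(c_{i,j})_{1\le i<j\le n+1,\ (i,j)\neq(1,n+1)}$ runs through the families of continuous maps $c_{i,j}\colon G\to\mathbb F_p$ with $c_{i,i+1}=\alpha_i$ for all $i$ and $\mathrm d c_{i,j}=\sum_{i<l<j}c_{i,l}\smallsmile c_{l,j}$ for all $(i,j)\ne(1,n+1)$; here $(a\smallsmile b)(g,h)=a(g)b(h)$ and $(\mathrm d c)(g,h)=c(h)-c(gh)+c(g)$. -/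

import Mathlib

noncomputable section

/-! ## Pro-`p` completions -/

/-- A normal subgroup of `H` whose index is a (finite) power of `p`. -/
structure PIndexSubgroup (p : ℕ) (H : Type*) [Group H] where
  /-- The underlying subgroup. -/
  toSubgroup : Subgroup H
  normal : toSubgroup.Normal
  index_eq : ∃ k : ℕ, toSubgroup.index = p ^ k

/-- The finite `p`-group `H ⧸ N`, regarded as a discrete topological group. -/
def PQuotient {p : ℕ} {H : Type*} [Group H] (N : PIndexSubgroup p H) : Type _ :=
  H ⧸ N.toSubgroup

namespace PQuotient

variable {p : ℕ} {H : Type*} [Group H]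

instance (N : PIndexSubgroup p H) : Group (PQuotient N) :=
  haveI := N.normal
  inferInstanceAs (Group (H ⧸ N.toSubgroup))

instance (N : PIndexSubgroup p H) : TopologicalSpace (PQuotient N) := ⊥

instance (N : PIndexSubgroup p H) : DiscreteTopology (PQuotient N) := ⟨rfl⟩

/-- The projection `H → H ⧸ N`. -/
def proj (N : PIndexSubgroup p H) : H →* PQuotient N :=
  haveI := N.normal
  QuotientGroup.mk' N.toSubgroup

/-- The canonical map `H ⧸ N → H ⧸ M` for `N ≤ M`. -/
def trans (N M : PIndexSubgroup p H) (h : N.toSubgroup ≤ M.toSubgroup) :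
    PQuotient N →* PQuotient M :=
  haveI := N.normal
  haveI := M.normal
  QuotientGroup.map N.toSubgroup M.toSubgroup (MonoidHom.id H) h

end PQuotient

/-- The pro-`p` completion of the abstract group `H`: the inverse limit of its finite quotients
`H ⧸ N` of `p`-power order, inside the product of all of these (with the product topology). -/
def proPCompletion (p : ℕ) (H : Type*) [Group H] :
    Subgroup (∀ N : PIndexSubgroup p H, PQuotient N) where
  carrier := {x | ∀ (N M : PIndexSubgroup p H) (h : N.toSubgroup ≤ M.toSubgroup),
    PQuotient.trans N M h (x N) = x M}
  one_mem' := fun N M h => map_one _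
  mul_mem' := fun hx hy N M h => by
    rw [Pi.mul_apply, Pi.mul_apply, map_mul, hx N M h, hy N M h]
  inv_mem' := fun hx N M h => by
    rw [Pi.inv_apply, Pi.inv_apply, map_inv, hx N M h]

/-- The canonical homomorphism of `H` into its pro-`p` completion. -/
def toProPCompletion (p : ℕ) (H : Type*) [Group H] : H →* proPCompletion p H where
  toFun x := ⟨fun N => PQuotient.proj N x, fun _ _ _ => rfl⟩
  map_one' := Subtype.ext (funext fun N => map_one (PQuotient.proj N))
  map_mul' x y := Subtype.ext (funext fun N => map_mul (PQuotient.proj N) x y)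

section Lift

variable {p : ℕ} [Fact p.Prime] {H : Type*} [Group H] {P : Type*} [Group P] [Finite P]

/-- The kernel of a homomorphism into a finite `p`-group, as a normal subgroup of `p`-power
index. -/
def kerPIndex (hP : IsPGroup p P) (φ : H →* P) : PIndexSubgroup p H where
  toSubgroup := φ.ker
  normal := φ.normal_ker
  index_eq := by
    rw [Subgroup.index_ker]
    exact IsPGroup.iff_card.mp (hP.to_subgroup φ.range)

/-- A homomorphism from `H` to a finite `p`-group extends to the pro-`p` completion of `H`. -/
def proPLift (hP : IsPGroup p P) (φ : H →* P) : proPCompletion p H →* P where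
  toFun x := QuotientGroup.kerLift φ (x.1 (kerPIndex hP φ))
  map_one' := map_one (QuotientGroup.kerLift φ)
  map_mul' _ _ := map_mul (QuotientGroup.kerLift φ) _ _

theorem proPLift_apply (hP : IsPGroup p P) (φ : H →* P) (x : H) :
    proPLift hP φ (toProPCompletion p H x) = φ x := rfl

theorem continuous_proPLift [TopologicalSpace P] (hP : IsPGroup p P) (φ : H →* P) :
    Continuous (proPLift hP φ) := by
  have h1 : Continuous fun y : PQuotient (kerPIndex hP φ) =>
      (QuotientGroup.kerLift φ : H ⧸ φ.ker → P) y := continuous_of_discreteTopology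
  exact h1.comp ((continuous_apply (kerPIndex hP φ)).comp continuous_subtype_val)

end Lift

/-! ## Oriented pro-`p` RAAGs -/

/-- The free pro-`p` group on the finite set `V`. -/
abbrev FreeProP (p : ℕ) (V : Type*) : Type _ := proPCompletion p (FreeGroup V)

/-- The free generator of the free pro-`p` group corresponding to `v`. -/
def FreeProP.of (p : ℕ) {V : Type*} (v : V) : FreeProP p V :=
  toProPCompletion p (FreeGroup V) (FreeGroup.of v)

/-- The defining relators of the oriented pro-`p` RAAG of a digraph, where
`[x, y] = x y x⁻¹ y⁻¹`: `[v, w]` for every undirected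
edge (that is, `(v, w)` and `(w, v)` are both edges), and `[w, v] * v ^ (-q)` for every directed
edge `(v, w)` (that is, `(v, w)` is an edge and `(w, v)` is not). -/
def raagRelators {V : Type*} (Γ : Digraph V) (p q : ℕ) : Set (FreeProP p V) :=
  {r | ∃ v w : V,
    (Γ.Adj v w ∧ Γ.Adj w v ∧
      r = FreeProP.of p v * FreeProP.of p w * (FreeProP.of p v)⁻¹ * (FreeProP.of p w)⁻¹) ∨
    (Γ.Adj v w ∧ ¬ Γ.Adj w v ∧
      r = FreeProP.of p w * FreeProP.of p v * (FreeProP.of p w)⁻¹ * (FreeProP.of p v)⁻¹ *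
        (FreeProP.of p v ^ q)⁻¹)}

/-- The closed normal subgroup of the free pro-`p` group generated by the relators. -/
def raagRelations {V : Type*} (Γ : Digraph V) (p q : ℕ) : Subgroup (FreeProP p V) :=
  (Subgroup.normalClosure (raagRelators Γ p q)).topologicalClosure

instance {V : Type*} (Γ : Digraph V) (p q : ℕ) : (raagRelations Γ p q).Normal :=
  Subgroup.is_normal_topologicalClosure _

/-- The oriented pro-`p` RAAG associated to the digraph `Γ` and to `q` (a power of `p`), with the
quotient topology. -/
abbrev OrientedRAAG {V : Type*} (Γ : Digraph V) (p q : ℕ) : Type _ :=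
  FreeProP p V ⧸ raagRelations Γ p q

/-- The generator of the oriented pro-`p` RAAG corresponding to the vertex `v`. -/
def OrientedRAAG.of {V : Type*} (Γ : Digraph V) (p q : ℕ) (v : V) : OrientedRAAG Γ p q :=
  QuotientGroup.mk (FreeProP.of p v)

/-! ## Continuous cochains with coefficients in `𝔽_p` -/

section Cochains

variable (p : ℕ) (G : Type*) [Group G] [TopologicalSpace G] [IsTopologicalGroup G]

/-- The coboundary `C¹(G) → C²(G)`, `(d f)(g, h) = f h - f (g h) + f g` (trivial action). -/
def coboundaryOne : C(G, ZMod p) →ₗ[ZMod p] C(G × G, ZMod p) where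
  toFun f := ⟨fun x => f x.2 - f (x.1 * x.2) + f x.1, by fun_prop⟩
  map_add' f g := by ext x; simp; ring
  map_smul' c f := by ext x; simp; ring

/-- The coboundary `C²(G) → C³(G)`,
`(d f)(g, h, k) = f (h, k) - f (g h, k) + f (g, h k) - f (g, h)` (trivial action). -/
def coboundaryTwo : C(G × G, ZMod p) →ₗ[ZMod p] C(G × G × G, ZMod p) where
  toFun f := ⟨fun x => f (x.2.1, x.2.2) - f (x.1 * x.2.1, x.2.2) + f (x.1, x.2.1 * x.2.2)
    - f (x.1, x.2.1), by fun_prop⟩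
  map_add' f g := by ext x; simp; ring
  map_smul' c f := by ext x; simp; ring

/-- `H¹(G, 𝔽_p)`, the space of continuous homomorphisms `G → 𝔽_p`: for the trivial action these
are the continuous `1`-cocycles, and the only `1`-coboundary is `0`. -/
abbrev ContH1 : Type _ := LinearMap.ker (coboundaryOne p G)

/-- The space of continuous `2`-cocycles. -/
abbrev ContZ2 : Submodule (ZMod p) C(G × G, ZMod p) := LinearMap.ker (coboundaryTwo p G)

/-- The space of continuous `2`-coboundaries, as a subspace of the space of `2`-cocycles. -/
abbrev ContB2 : Submodule (ZMod p) (ContZ2 p G) :=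
  (LinearMap.range (coboundaryOne p G)).submoduleOf (ContZ2 p G)

/-- The continuous cohomology group `H²(G, 𝔽_p)`. -/
abbrev ContH2 : Type _ := ContZ2 p G ⧸ ContB2 p G

variable {p G}

/-- The cup product of two `1`-cochains: the `2`-cochain `(g, h) ↦ a g * b h`. -/
def cupOne (a b : C(G, ZMod p)) : C(G × G, ZMod p) :=
  ⟨fun x => a x.1 * b x.2, by fun_prop⟩

/-- `c = (c i j)`, for `0 ≤ i < j ≤ n` with `(i, j) ≠ (0, n)`, is a defining system for the `n`-fold
Massey product `⟨α 0, …, α (n - 1)⟩`: one has `c i (i + 1) = α i`, and `d (c i j)` is the sum of the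
cup products `c i l ∪ c l j` over `i < l < j`. (The other entries of `c` play no role.) -/
structure IsMasseyDefiningSystem {n : ℕ} (α : Fin n → ContH1 p G)
    (c : Fin (n + 1) → Fin (n + 1) → C(G, ZMod p)) : Prop where
  diag : ∀ i : Fin n, c i.castSucc i.succ = (α i).1
  coboundary : ∀ i j : Fin (n + 1), i < j → (i, j) ≠ (0, Fin.last n) →
    coboundaryOne p G (c i j) = ∑ l ∈ Finset.Ioo i j, cupOne (c i l) (c l j)

/-- The `n`-fold Massey product `⟨α 0, …, α (n - 1)⟩ ⊆ H²(G, 𝔽_p)`: the set of the classes of the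
`2`-cocycles `∑_{0 < l < n} c 0 l ∪ c l n`, for all defining systems `c`. -/
def masseyProduct {n : ℕ} (α : Fin n → ContH1 p G) : Set (ContH2 p G) :=
  {x | ∃ c : Fin (n + 1) → Fin (n + 1) → C(G, ZMod p), IsMasseyDefiningSystem α c ∧
    ∃ z : ContZ2 p G,
      z.1 = ∑ l ∈ Finset.Ioo 0 (Fin.last n), cupOne (c 0 l) (c l (Fin.last n)) ∧
      (ContB2 p G).mkQ z = x}

/-- A Massey product is essential if it is defined (nonempty) and does not vanish (does not contain
`0`). -/
def MasseyEssential {n : ℕ} (α : Fin n → ContH1 p G) : Prop :=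
  (masseyProduct α).Nonempty ∧ (0 : ContH2 p G) ∉ masseyProduct α

/-- The sequence `α, β, …, β, α` of length `n`, whose first and last terms are `α`. -/
def endsSequence {M : Type*} (n : ℕ) (α β : M) : Fin n → M :=
  fun i => if i.val = 0 ∨ i.val + 1 = n then α else β

end Cochains

/-! ## The dual basis of `H¹` of an oriented pro-`p` RAAG -/

section Dual

variable {V : Type*} {p : ℕ} [Fact p.Prime]

theorem isPGroup_multiplicative_zmod (p : ℕ) [Fact p.Prime] :
    IsPGroup p (Multiplicative (ZMod p)) :=
  IsPGroup.of_card (n := 1) (by simp [Nat.card_eq_fintype_card])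

open Classical in
/-- The continuous homomorphism from the free pro-`p` group to `𝔽_p` that maps the generator `u`
to `1` and all the other generators to `0`. -/
def freeVertexDual (p : ℕ) [Fact p.Prime] (u : V) : FreeProP p V →* Multiplicative (ZMod p) :=
  proPLift (isPGroup_multiplicative_zmod p)
    (FreeGroup.lift fun x => Multiplicative.ofAdd (if x = u then (1 : ZMod p) else 0))

theorem raagRelations_le_ker (Γ : Digraph V) {q : ℕ} (hq : p ∣ q) (u : V) :
    raagRelations Γ p q ≤ (freeVertexDual p u).ker := by
  have hc : Continuous (freeVertexDual p u) := continuous_proPLift _ _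
  refine Subgroup.topologicalClosure_minimal _ ?_ ?_
  · refine Subgroup.normalClosure_le_normal ?_
    rintro r ⟨v, w, ⟨-, -, rfl⟩ | ⟨-, -, rfl⟩⟩
    · simp [MonoidHom.mem_ker]
    · have h : ∀ y : Multiplicative (ZMod p), y ^ q = 1 := fun y => by
        obtain ⟨k, rfl⟩ := hq
        apply Multiplicative.toAdd.injective
        simp
      simp [MonoidHom.mem_ker, h]
  · exact isClosed_singleton.preimage hc

/-- The homomorphism of pro-`p` groups induced by `u^* : V → 𝔽_p` on the oriented pro-`p` RAAG. -/
def vertexDualHom (Γ : Digraph V) {q : ℕ} (hq : p ∣ q) (u : V) :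
    OrientedRAAG Γ p q →* Multiplicative (ZMod p) :=
  QuotientGroup.lift (raagRelations Γ p q) (freeVertexDual p u)
    (fun _ hx => raagRelations_le_ker Γ hq u hx)

theorem continuous_vertexDualHom (Γ : Digraph V) {q : ℕ} (hq : p ∣ q) (u : V) :
    Continuous (vertexDualHom Γ hq u) :=
  Continuous.quotient_lift (continuous_proPLift _ _) _

/-- The class `u^* ∈ H¹(G, 𝔽_p)` of a vertex `u`, for the oriented pro-`p` RAAG `G`: the continuous
homomorphism `G → 𝔽_p` that maps `u` to `1` and all the other vertices to `0`. -/
def vertexDual (Γ : Digraph V) {q : ℕ} (hq : p ∣ q) (u : V) : ContH1 p (OrientedRAAG Γ p q) :=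
  ⟨⟨fun x => Multiplicative.toAdd (vertexDualHom Γ hq u x),
    continuous_toAdd.comp (continuous_vertexDualHom Γ hq u)⟩, by
    ext x
    simp [coboundaryOne]⟩

open Classical in
theorem vertexDual_of (Γ : Digraph V) {q : ℕ} (hq : p ∣ q) (u v : V) :
    (vertexDual Γ hq u).1 (OrientedRAAG.of Γ p q v) = if v = u then 1 else 0 := by
  change Multiplicative.toAdd (FreeGroup.lift
    (fun x => Multiplicative.ofAdd (if x = u then (1 : ZMod p) else 0)) (FreeGroup.of v)) = _
  simp

end Dual

/-- The three distinct vertices `u`, `v`, `w` of the (loopless) digraph `Γ` span an induced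
subdigraph in which `(u, w)` is a directed edge, `u` and `v` are not joined, and either `(v, w)` is
a directed edge, or `(w, v)` is an edge (directed or not). -/
structure IsNonCliqueSpecialTriple {V : Type*} (Γ : Digraph V) (u v w : V) : Prop where
  ne_uv : u ≠ v
  ne_uw : u ≠ w
  ne_vw : v ≠ w
  adj_uw : Γ.Adj u w
  not_adj_wu : ¬ Γ.Adj w u
  not_adj_uv : ¬ Γ.Adj u v
  not_adj_vu : ¬ Γ.Adj v u
  vw : (Γ.Adj v w ∧ ¬ Γ.Adj w v) ∨ Γ.Adj w v

end

noncomputable section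

/-! Write `n` for `q = p ^ f`. By Dwyer's dictionary, a defining system is, up to sign, a family of
entries of a unitriangular `(n + 1) × (n + 1)` representation of `G` with the upper right corner
left out. The Massey product contains `0` exactly when some such family can be completed at the
corner to a genuine homomorphism.

Non-vanishing (`zero_notMem_masseyProduct_of_triple`): let a completed homomorphism send `u, v, w`
to `1 + N, 1 + M, 1 + D`. The superdiagonal of `N` is constantly `-1`, that of `M` is `-1` at its
two ends and `0` between, and that of `D` is `0`. Since `(1 + X) ^ n = 1 + X ^ n` in characteristic
`p` and `X ^ n` is concentrated at the corner, the edge `(u, w)` gives `D * N = N * D + N ^ n`. As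
`M ^ n = D ^ n = 0`, every permitted edge between `v` and `w` gives `D * M = M * D`. Comparing
superdiagonals one after another clears `D` below the `(n - 1)`-st one, and the corner entries then
force `N ^ n = 0` (`eq_zero_of_commutator_relations`). But the corner of `N ^ n` is `(-1) ^ n`.

Non-emptiness (`masseyProduct_nonempty`): map `u` and `v` to matrices with the prescribed
superdiagonals and all other vertices to `1`. Since `u` and `v` are not joined, the images of
adjacent vertices commute, and `n`-th powers lie in the central corner subgroup. All relators
therefore land in that subgroup, and every entry off the corner descends to `G`. -/

/-! ## Matrices supported on high superdiagonals -/

/-- The matrix `A` vanishes below its `k`-th superdiagonal. -/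
def OffsetGE {R : Type*} [Zero R] {n : ℕ} (k : ℕ) (A : Matrix (Fin n) (Fin n) R) : Prop :=
  ∀ i j : Fin n, j.val < i.val + k → A i j = 0

namespace OffsetGE

variable {R : Type*} [Ring R] {n : ℕ} {a b : ℕ} {A B : Matrix (Fin n) (Fin n) R}

theorem mono (hA : OffsetGE a A) (h : b ≤ a) : OffsetGE b A :=
  fun i j hij => hA i j (by omega)

theorem eq_zero (hA : OffsetGE a A) (h : n ≤ a) : A = 0 := by
  ext i j
  exact hA i j (by omega)

theorem zero : OffsetGE a (0 : Matrix (Fin n) (Fin n) R) := fun _ _ _ => rfl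

theorem one : OffsetGE 0 (1 : Matrix (Fin n) (Fin n) R) :=
  fun i j h => Matrix.one_apply_ne (by rintro rfl; omega)

theorem add (hA : OffsetGE a A) (hB : OffsetGE a B) : OffsetGE a (A + B) :=
  fun i j h => by rw [Matrix.add_apply, hA i j h, hB i j h, add_zero]

theorem neg (hA : OffsetGE a A) : OffsetGE a (-A) :=
  fun i j h => by rw [Matrix.neg_apply, hA i j h, neg_zero]

theorem mul (hA : OffsetGE a A) (hB : OffsetGE b B) : OffsetGE (a + b) (A * B) := by
  intro i j h
  rw [Matrix.mul_apply]
  refine Finset.sum_eq_zero fun l _ => ?_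
  by_cases hl : l.val < i.val + a
  · rw [hA i l hl, zero_mul]
  · rw [hB l j (by omega), mul_zero]

theorem mul_eq_zero (hA : OffsetGE a A) (hB : OffsetGE b B) (h : n ≤ a + b) : A * B = 0 :=
  (hA.mul hB).eq_zero h

theorem pow (hA : OffsetGE a A) (k : ℕ) : OffsetGE (k * a) (A ^ k) := by
  induction k with
  | zero => simpa using one
  | succ k ih => rw [pow_succ, Nat.succ_mul]; exact ih.mul hA

/-- On the lowest superdiagonal where a product can be nonzero, only one intermediate index
contributes. -/
theorem mul_apply (hA : OffsetGE a A) (hB : OffsetGE b B) {i m j : Fin n}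
    (him : m.val = i.val + a) (hmj : j.val = m.val + b) : (A * B) i j = A i m * B m j := by
  rw [Matrix.mul_apply]
  refine Finset.sum_eq_single m (fun l _ hl => ?_) (fun h => absurd (Finset.mem_univ m) h)
  have hl' : l.val ≠ m.val := fun h => hl (Fin.ext h)
  by_cases h : l.val < i.val + a
  · rw [hA i l h, zero_mul]
  · rw [hB l j (by omega), mul_zero]

end OffsetGE

/-! ### Commutator relations and `p`-power maps for unitriangular matrices -/

section Commutators

variable {R : Type*} [CommRing R] {n : ℕ}

/-- The commutator relations satisfied by the images of the three vertices of a special triple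
under a unitriangular representation force the corner of `N ^ n` to vanish. -/
theorem eq_zero_of_commutator_relations (hn : 3 ≤ n)
    {D N M K : Matrix (Fin (n + 1)) (Fin (n + 1)) R}
    (hD : OffsetGE 2 D) (hN : OffsetGE 1 N) (hM : OffsetGE 1 M) (hK : OffsetGE n K)
    (hNs : ∀ i j : Fin (n + 1), j.val = i.val + 1 → N i j = -1)
    (hMs : ∀ i j : Fin (n + 1), j.val = i.val + 1 →
      M i j = if i.val = 0 ∨ i.val + 1 = n then -1 else 0)
    (hDM : D * M = M * D) (hDN : D * N = N * D + K) : K = 0 := by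
  have key : ∀ d, 2 ≤ d → d ≤ n - 1 → OffsetGE d D := by
    intro d hd
    induction d, hd using Nat.le_induction with
    | base => exact fun _ => hD
    | succ d hd ih =>
      intro hdn
      have hDd := ih (by omega)
      -- Below the corner `K` does not contribute, so the relation with `N` makes the `d`-th
      -- superdiagonal of `D` constant.
      have hshift : ∀ i (hi : i + d + 1 < n + 1),
          D ⟨i, by omega⟩ ⟨i + d, by omega⟩ = D ⟨i + 1, by omega⟩ ⟨i + d + 1, hi⟩ := by
        intro i hi
        have h := congrFun (congrFun hDN ⟨i, by omega⟩) ⟨i + d + 1, hi⟩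
        rw [Matrix.add_apply, hK ⟨i, by omega⟩ ⟨i + d + 1, hi⟩ (by simp only; omega),
          hDd.mul_apply hN (m := ⟨i + d, by omega⟩) rfl rfl,
          hN.mul_apply hDd (m := ⟨i + 1, by omega⟩) rfl (by simp only; omega),
          hNs _ _ rfl, hNs _ _ rfl] at h
        linear_combination -h
      -- The relation with `M` is read at `(0, d + 1)`: position `d` is interior, so `M` vanishes
      -- there, while its first superdiagonal entry is `-1`.
      have hone : D ⟨1, by omega⟩ ⟨d + 1, by omega⟩ = 0 := by
        have h := congrFun (congrFun hDM ⟨0, by omega⟩) ⟨d + 1, by omega⟩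
        rw [hDd.mul_apply hM (m := ⟨d, by omega⟩) (by simp) rfl,
          hM.mul_apply hDd (m := ⟨1, by omega⟩) (by simp) (by simp only; omega),
          hMs _ _ rfl, hMs _ _ (by simp), if_neg (by simp only; omega), if_pos (by simp)] at h
        linear_combination h
      have hall : ∀ i (hi : i + d < n + 1), D ⟨i, by omega⟩ ⟨i + d, hi⟩ = 0 := by
        have hzero : D ⟨0, by omega⟩ ⟨0 + d, by omega⟩ = 0 := by
          rw [hshift 0 (by omega)]
          simpa using hone
        intro i
        induction i with
        | zero => exact fun _ => hzero
        | succ i ihi =>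
          intro hi
          have h := ihi (by omega)
          rw [hshift i (by omega)] at h
          convert h using 2
          exact Fin.ext (by simp only; omega)
      intro i j hij
      by_cases hlt : j.val < i.val + d
      · exact hDd i j hlt
      · have hj : j = ⟨i.val + d, by omega⟩ := Fin.ext (by simp only; omega)
        rw [hj]
        exact hall i.val _
  have hDn : OffsetGE (n - 1) D := key (n - 1) (by omega) le_rfl
  -- At the corner both relations involve only the entries `(0, n - 1)` and `(1, n)` of `D`. `M` and
  -- `N` agree at both ends of the superdiagonal, so subtraction isolates `K`.
  have hcorner : K ⟨0, by omega⟩ ⟨n, by omega⟩ = 0 := by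
    have h1 := congrFun (congrFun hDN ⟨0, by omega⟩) ⟨n, by omega⟩
    have h2 := congrFun (congrFun hDM ⟨0, by omega⟩) ⟨n, by omega⟩
    rw [Matrix.add_apply, hDn.mul_apply hN (m := ⟨n - 1, by omega⟩) (by simp) (by simp only; omega),
      hN.mul_apply hDn (m := ⟨1, by omega⟩) (by simp) (by simp only; omega),
      hNs _ _ (by simp only; omega), hNs _ _ (by simp)] at h1
    rw [hDn.mul_apply hM (m := ⟨n - 1, by omega⟩) (by simp) (by simp only; omega),
      hM.mul_apply hDn (m := ⟨1, by omega⟩) (by simp) (by simp only; omega),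
      hMs _ _ (by simp only; omega), hMs _ _ (by simp), if_pos (by simp only; omega),
      if_pos (by simp)] at h2
    linear_combination h2 - h1
  ext i j
  by_cases hij : j.val < i.val + n
  · exact hK i j hij
  · rw [show i = ⟨0, by omega⟩ from Fin.ext (by simp only; omega),
      show j = ⟨n, by omega⟩ from Fin.ext (by simp only; omega)]
    exact hcorner

theorem OffsetGE.pow_apply_zero {N : Matrix (Fin (n + 1)) (Fin (n + 1)) R} (hN : OffsetGE 1 N)
    (c : R) (hNs : ∀ i j : Fin (n + 1), j.val = i.val + 1 → N i j = c) (k : ℕ) (hk : k < n + 1) :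
    (N ^ k) 0 ⟨k, hk⟩ = c ^ k := by
  induction k with
  | zero => rw [pow_zero, pow_zero]; exact Matrix.one_apply_eq (0 : Fin (n + 1))
  | succ k ih =>
    rw [pow_succ, (hN.pow k).mul_apply hN (m := ⟨k, by omega⟩) (by simp) rfl, ih (by omega),
      hNs _ _ rfl, pow_succ]

/-- A strictly upper triangular matrix of size `n + 1` has vanishing `n`-th power as soon as two
consecutive entries at the beginning of its first superdiagonal multiply to zero. -/
theorem OffsetGE.pow_eq_zero {N : Matrix (Fin (n + 1)) (Fin (n + 1)) R} (hN : OffsetGE 1 N)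
    (hn : 2 ≤ n) (h : N ⟨0, by omega⟩ ⟨1, by omega⟩ * N ⟨1, by omega⟩ ⟨2, by omega⟩ = 0) :
    N ^ n = 0 := by
  ext i j
  by_cases hij : j.val < i.val + n
  · exact hN.pow n i j (by omega)
  · have hpow : N ^ n = N ^ 2 * N ^ (n - 2) := by rw [← pow_add]; congr 1; omega
    rw [hpow, show i = ⟨0, by omega⟩ from Fin.ext (by simp only; omega),
      (hN.pow 2).mul_apply (hN.pow (n - 2)) (m := ⟨2, by omega⟩) (by simp) (by simp only at *; omega),
      pow_two, hN.mul_apply hN (m := ⟨1, by omega⟩) (by simp) (by simp), h, zero_mul]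
    rfl

theorem one_add_pow_of_eq_char_pow {p k q : ℕ} [Fact p.Prime] [CharP R p] (hq : q = p ^ k)
    (N : Matrix (Fin (n + 1)) (Fin (n + 1)) R) : (1 + N) ^ q = 1 + N ^ q := by
  rw [hq, add_pow_char_pow_of_commute _ _ (Commute.one_left N), one_pow]

end Commutators

/-! ## Representations attached to defining systems -/

section Representation

variable {p : ℕ} {G : Type*} [TopologicalSpace G] {n : ℕ}

/-- The strictly upper triangular matrix with the entries `-c i j g`. -/
def strictMatrix (c : Fin (n + 1) → Fin (n + 1) → C(G, ZMod p)) (g : G) :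
    Matrix (Fin (n + 1)) (Fin (n + 1)) (ZMod p) :=
  fun i j => if i < j then -c i j g else 0

theorem offsetGE_strictMatrix (c : Fin (n + 1) → Fin (n + 1) → C(G, ZMod p)) (g : G) :
    OffsetGE 1 (strictMatrix c g) :=
  fun i j h => if_neg (by rw [Fin.lt_def]; omega)

variable [Group G] [IsTopologicalGroup G]

/-- The product of strictly upper triangular matrices, as a sum over an open interval. -/
theorem OffsetGE.mul_apply_eq_sum_Ioo {R : Type*} [Ring R] {A B : Matrix (Fin n) (Fin n) R}
    (hA : OffsetGE 1 A) (hB : OffsetGE 1 B) (i j : Fin n) :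
    (A * B) i j = ∑ l ∈ Finset.Ioo i j, A i l * B l j := by
  rw [Matrix.mul_apply]
  refine (Finset.sum_subset (Finset.subset_univ _) fun l _ hl => ?_).symm
  by_cases h : i < l
  · have : ¬ l < j := fun h' => hl (Finset.mem_Ioo.2 ⟨h, h'⟩)
    rw [hB l j (by rw [Fin.lt_def] at this; omega), mul_zero]
  · rw [hA i l (by rw [Fin.lt_def] at h; omega), zero_mul]

/-- The sign in `strictMatrix` turns `dc = ∑ c ∪ c` into multiplicativity of `1 + strictMatrix c`.
-/
theorem strictMatrix_mul {c : Fin (n + 1) → Fin (n + 1) → C(G, ZMod p)}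
    (hc : ∀ i j, i < j → coboundaryOne p G (c i j) = ∑ l ∈ Finset.Ioo i j, cupOne (c i l) (c l j))
    (g h : G) : strictMatrix c (g * h) =
      strictMatrix c g + strictMatrix c h + strictMatrix c g * strictMatrix c h := by
  ext i j
  rw [Matrix.add_apply, Matrix.add_apply,
    (offsetGE_strictMatrix c g).mul_apply_eq_sum_Ioo (offsetGE_strictMatrix c h)]
  by_cases hij : i < j
  · have h1 := DFunLike.congr_fun (hc i j hij) (g, h)
    rw [ContinuousMap.sum_apply] at h1
    have h2 : ∑ l ∈ Finset.Ioo i j, strictMatrix c g i l * strictMatrix c h l j =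
        ∑ l ∈ Finset.Ioo i j, cupOne (c i l) (c l j) (g, h) := by
      refine Finset.sum_congr rfl fun l hl => ?_
      obtain ⟨hil, hlj⟩ := Finset.mem_Ioo.1 hl
      simp [strictMatrix, hil, hlj, cupOne]
    rw [h2, ← h1]
    simp [strictMatrix, hij, coboundaryOne]
    ring
  · rw [Finset.Ioo_eq_empty hij, Finset.sum_empty]
    simp [strictMatrix, hij]

/-- The unitriangular representation attached to a family of cochains which satisfies all the
equations of a defining system, including the one at the corner. -/
def unitriangularHom (c : Fin (n + 1) → Fin (n + 1) → C(G, ZMod p))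
    (hc : ∀ i j, i < j → coboundaryOne p G (c i j) =
      ∑ l ∈ Finset.Ioo i j, cupOne (c i l) (c l j)) :
    G →* Matrix (Fin (n + 1)) (Fin (n + 1)) (ZMod p) where
  toFun g := 1 + strictMatrix c g
  map_one' := by
    -- Multiplicativity at `(1, 1)` gives `X * (1 + X) = 0`, and `1 + X` is a unit because `X` is
    -- nilpotent.
    have h : strictMatrix c 1 * (1 + strictMatrix c 1) = 0 := by
      have h1 := strictMatrix_mul hc 1 1
      rw [mul_one] at h1
      rw [mul_add, mul_one]
      have h2 : strictMatrix c 1 + strictMatrix c 1 * strictMatrix c 1 = 0 := by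
        have h3 : strictMatrix c 1 + (strictMatrix c 1 + strictMatrix c 1 * strictMatrix c 1) =
            strictMatrix c 1 + 0 := by rw [← add_assoc, ← h1, add_zero]
        exact add_left_cancel h3
      exact h2
    have hu : IsUnit (1 + strictMatrix c 1) :=
      IsNilpotent.isUnit_one_add ⟨n + 1, ((offsetGE_strictMatrix c 1).pow (n + 1)).eq_zero (by simp)⟩
    rw [hu.mul_left_eq_zero.1 h, add_zero]
  map_mul' g h := by rw [strictMatrix_mul hc]; noncomm_ring

/-- If a Massey product contains zero, it has a defining system that extends to the corner. -/
theorem exists_extended_system_of_zero_mem {α : Fin n → ContH1 p G} (hn : 2 ≤ n)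
    (h : (0 : ContH2 p G) ∈ masseyProduct α) :
    ∃ c : Fin (n + 1) → Fin (n + 1) → C(G, ZMod p),
      (∀ i : Fin n, c i.castSucc i.succ = (α i).1) ∧
      ∀ i j, i < j → coboundaryOne p G (c i j) =
        ∑ l ∈ Finset.Ioo i j, cupOne (c i l) (c l j) := by
  classical
  obtain ⟨c, hc, z, hz, hz0⟩ := h
  obtain ⟨b, hb⟩ : z.1 ∈ LinearMap.range (coboundaryOne p G) := by
    rw [Submodule.mkQ_apply, Submodule.Quotient.mk_eq_zero] at hz0
    exact hz0
  -- A cochain bounding the Massey cocycle serves as the missing corner entry; the sums over open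
  -- intervals never involve that entry.
  refine ⟨fun i j => if (i, j) = (0, Fin.last n) then b else c i j, fun i => ?_, ?_⟩
  · simp only
    rw [if_neg, hc.diag i]
    intro h
    have h1 := congrArg Fin.val (Prod.mk.inj h).1
    have h2 := congrArg Fin.val (Prod.mk.inj h).2
    simp at h1 h2
    omega
  · intro i j hij
    have hsum : ∑ l ∈ Finset.Ioo i j, cupOne (if (i, l) = (0, Fin.last n) then b else c i l)
        (if (l, j) = (0, Fin.last n) then b else c l j) =
        ∑ l ∈ Finset.Ioo i j, cupOne (c i l) (c l j) := by
      refine Finset.sum_congr rfl fun l hl => ?_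
      obtain ⟨hil, hlj⟩ := Finset.mem_Ioo.1 hl
      rw [if_neg, if_neg]
      · intro h
        rw [(Prod.mk.inj h).1] at hil
        exact absurd hil (Fin.not_lt_zero i)
      · intro h
        rw [(Prod.mk.inj h).2] at hlj
        exact absurd hlj (not_lt.2 (Fin.le_last j))
    simp only [hsum]
    by_cases h : (i, j) = (0, Fin.last n)
    · obtain ⟨rfl, rfl⟩ := Prod.mk.inj h
      rw [if_pos rfl, hb, hz]
    · rw [if_neg h, hc.coboundary i j hij h]

end Representation

/-! ## Relations of the generators -/

section Relations

variable {V : Type*} (Γ : Digraph V) (p q : ℕ)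

theorem OrientedRAAG.commute_of_undirected {v w : V} (h1 : Γ.Adj v w) (h2 : Γ.Adj w v) :
    of Γ p q v * of Γ p q w = of Γ p q w * of Γ p q v := by
  have h : ((FreeProP.of p v * FreeProP.of p w * (FreeProP.of p v)⁻¹ * (FreeProP.of p w)⁻¹ :
      FreeProP p V) : OrientedRAAG Γ p q) = 1 :=
    (QuotientGroup.eq_one_iff _).2 (Subgroup.le_topologicalClosure _
      (Subgroup.subset_normalClosure ⟨v, w, Or.inl ⟨h1, h2, rfl⟩⟩))
  have h' : of Γ p q v * of Γ p q w * (of Γ p q v)⁻¹ * (of Γ p q w)⁻¹ = 1 := h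
  rw [mul_inv_eq_one, mul_inv_eq_iff_eq_mul] at h'
  exact h'

theorem OrientedRAAG.mul_of_directed {v w : V} (h1 : Γ.Adj v w) (h2 : ¬ Γ.Adj w v) :
    of Γ p q w * of Γ p q v = of Γ p q v ^ q * (of Γ p q v * of Γ p q w) := by
  have h : ((FreeProP.of p w * FreeProP.of p v * (FreeProP.of p w)⁻¹ * (FreeProP.of p v)⁻¹ *
      (FreeProP.of p v ^ q)⁻¹ : FreeProP p V) : OrientedRAAG Γ p q) = 1 :=
    (QuotientGroup.eq_one_iff _).2 (Subgroup.le_topologicalClosure _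
      (Subgroup.subset_normalClosure ⟨v, w, Or.inr ⟨h1, h2, rfl⟩⟩))
  have h' : of Γ p q w * of Γ p q v * (of Γ p q w)⁻¹ * (of Γ p q v)⁻¹ *
      (of Γ p q v ^ q)⁻¹ = 1 := h
  rw [mul_inv_eq_one, mul_inv_eq_iff_eq_mul, mul_inv_eq_iff_eq_mul, mul_assoc] at h'
  exact h'

end Relations

theorem zero_notMem_masseyProduct_of_triple {V : Type*} (Γ : Digraph V) {p f n : ℕ} [Fact p.Prime]
    (hndef : n = p ^ f) (hpn : p ∣ n) (hn : 3 ≤ n) (u v w : V) (huvw : IsNonCliqueSpecialTriple Γ u v w) :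
    (0 : ContH2 p (OrientedRAAG Γ p n)) ∉ masseyProduct (endsSequence n
      (vertexDual Γ hpn u + vertexDual Γ hpn v)
      (vertexDual Γ hpn u)) := by
  intro h0
  obtain ⟨c, hdiag, hc⟩ := exists_extended_system_of_zero_mem (by omega) h0
  set ρ := unitriangularHom c hc
  set g := OrientedRAAG.of Γ p n
  have hρ : ∀ x, ρ x = 1 + strictMatrix c x := fun _ => rfl
  have hoff : ∀ x, OffsetGE 1 (strictMatrix c x) := offsetGE_strictMatrix c
  have hpow : ∀ x, ρ (x ^ n) = 1 + strictMatrix c x ^ n := fun x => by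
    rw [map_pow, hρ, one_add_pow_of_eq_char_pow hndef]
  have hcomm : ∀ x y, x * y = y * x →
      strictMatrix c x * strictMatrix c y = strictMatrix c y * strictMatrix c x := by
    intro x y h
    have h' := congrArg ρ h
    rw [map_mul, map_mul, hρ, hρ] at h'
    have h2 : strictMatrix c x * strictMatrix c y - strictMatrix c y * strictMatrix c x =
      (1 + strictMatrix c x) * (1 + strictMatrix c y) -
        (1 + strictMatrix c y) * (1 + strictMatrix c x) := by noncomm_ring
    rw [h', sub_self] at h2
    exact sub_eq_zero.1 h2
  have hdir : ∀ x y, y * x = x ^ n * (x * y) → strictMatrix c y * strictMatrix c x =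
      strictMatrix c x * strictMatrix c y + strictMatrix c x ^ n := by
    intro x y h
    have h' := congrArg ρ h
    rw [map_mul, map_mul, map_mul, hpow, hρ, hρ] at h'
    -- `X ^ n` lives at the corner only, so any further strictly upper triangular factor kills it.
    have hx := ((hoff x).pow n).mul_eq_zero (hoff x) (by omega)
    have hy := ((hoff x).pow n).mul_eq_zero (hoff y) (by omega)
    set X := strictMatrix c x
    set Y := strictMatrix c y
    set K := X ^ n
    have h2 : Y * X - (X * Y + K) = (1 + Y) * (1 + X) - (1 + K) * ((1 + X) * (1 + Y)) +
        (K * X + K * Y + K * X * Y) := by noncomm_ring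
    rw [h', sub_self, hx, hy, zero_mul, add_zero, add_zero, add_zero] at h2
    exact sub_eq_zero.1 h2
  have hentry : ∀ (x : V) (i j : Fin (n + 1)) (_ : j.val = i.val + 1),
      strictMatrix c (g x) i j = -((endsSequence n
        (vertexDual Γ hpn u + vertexDual Γ hpn v)
        (vertexDual Γ hpn u) ⟨i.val, by have := j.isLt; omega⟩).1 (g x)) := by
    intro x i j hij
    have hi : i.val < n := by have := j.isLt; omega
    rw [← hdiag ⟨i.val, hi⟩, strictMatrix, if_pos (by rw [Fin.lt_def]; omega)]
    have hj : j = Fin.succ ⟨i.val, hi⟩ := Fin.ext hij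
    rw [hj]
    rfl
  have huu := vertexDual_of Γ hpn u u
  have hvv := vertexDual_of Γ hpn v v
  have huv := vertexDual_of Γ hpn u v
  have hvu := vertexDual_of Γ hpn v u
  have huw := vertexDual_of Γ hpn u w
  have hvw := vertexDual_of Γ hpn v w
  rw [if_pos rfl] at huu hvv
  rw [if_neg huvw.ne_uv.symm] at huv
  rw [if_neg huvw.ne_uv] at hvu
  rw [if_neg huvw.ne_uw.symm] at huw
  rw [if_neg huvw.ne_vw.symm] at hvw
  have hN : ∀ i j : Fin (n + 1), j.val = i.val + 1 → strictMatrix c (g u) i j = -1 := by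
    intro i j hij
    rw [hentry u i j hij]
    unfold endsSequence
    split_ifs
    · exact congrArg Neg.neg ((congrArg₂ (· + ·) huu hvu).trans (add_zero 1))
    · exact congrArg Neg.neg huu
  have hM : ∀ i j : Fin (n + 1), j.val = i.val + 1 → strictMatrix c (g v) i j =
      if i.val = 0 ∨ i.val + 1 = n then -1 else 0 := by
    intro i j hij
    rw [hentry v i j hij]
    unfold endsSequence
    simp only
    split_ifs
    · exact congrArg Neg.neg ((congrArg₂ (· + ·) huv hvv).trans (zero_add 1))
    · exact (congrArg Neg.neg huv).trans neg_zero
  have hDs : ∀ i j : Fin (n + 1), j.val = i.val + 1 → strictMatrix c (g w) i j = 0 := by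
    intro i j hij
    rw [hentry w i j hij]
    unfold endsSequence
    split_ifs
    · exact (congrArg Neg.neg ((congrArg₂ (· + ·) huw hvw).trans (add_zero 0))).trans neg_zero
    · exact (congrArg Neg.neg huw).trans neg_zero
  have hD : OffsetGE 2 (strictMatrix c (g w)) := by
    intro i j hij
    by_cases h : j.val < i.val + 1
    · exact hoff _ i j h
    · exact hDs i j (by omega)
  -- Since `n ≥ 3`, position `1` is interior, and there the superdiagonal entry for `v` is `0`.
  have hMn : strictMatrix c (g v) ^ n = 0 := by
    refine (hoff _).pow_eq_zero (by omega) ?_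
    rw [hM ⟨1, by omega⟩ ⟨2, by omega⟩ rfl, if_neg (by simp only; omega), mul_zero]
  have hDn : strictMatrix c (g w) ^ n = 0 := by
    refine (hoff _).pow_eq_zero (by omega) ?_
    rw [hDs ⟨1, by omega⟩ ⟨2, by omega⟩ rfl, mul_zero]
  -- Whichever way the edge between `v` and `w` is directed, its power term is `M ^ n` or `D ^ n`,
  -- hence zero.
  have hDM : strictMatrix c (g w) * strictMatrix c (g v) =
      strictMatrix c (g v) * strictMatrix c (g w) := by
    by_cases hwv : Γ.Adj w v
    · by_cases hvw' : Γ.Adj v w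
      · exact hcomm _ _ (OrientedRAAG.commute_of_undirected Γ p n hwv hvw')
      · have h := hdir _ _ (OrientedRAAG.mul_of_directed Γ p n hwv hvw')
        rw [hDn, add_zero] at h
        exact h.symm
    · have hvw' : Γ.Adj v w := by
        rcases huvw.vw with h | h
        · exact h.1
        · exact absurd h hwv
      have h := hdir _ _ (OrientedRAAG.mul_of_directed Γ p n hvw' hwv)
      rw [hMn, add_zero] at h
      exact h
  have hDN := hdir _ _ (OrientedRAAG.mul_of_directed Γ p n huvw.adj_uw huvw.not_adj_wu)
  have hK : OffsetGE n (strictMatrix c (g u) ^ n) := ((hoff _).pow n).mono (by omega)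
  have hzero := eq_zero_of_commutator_relations hn hD (hoff _) (hoff _) hK hN hM hDM hDN
  have hcorner := (hoff (g u)).pow_apply_zero (-1) hN n (by omega)
  rw [hzero] at hcorner
  exact pow_ne_zero n (neg_ne_zero.2 one_ne_zero) hcorner.symm

/-! ## The group of unitriangular matrices -/

section Unitriangular

/-- The monoid of unitriangular matrices. -/
def unitriangularSubmonoid (n p : ℕ) : Submonoid (Matrix (Fin n) (Fin n) (ZMod p)) where
  carrier := {A | OffsetGE 1 (A - 1)}
  one_mem' := by
    rw [Set.mem_ofPred_eq, sub_self]
    exact OffsetGE.zero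
  mul_mem' {A B} hA hB := by
    have h : A * B - 1 = (A - 1) + (B - 1) + (A - 1) * (B - 1) := by noncomm_ring
    rw [Set.mem_ofPred_eq, h]
    exact (hA.add hB).add ((hA.mul hB).mono (by omega))

/-- The group of unitriangular matrices, with the discrete topology. -/
def Unitriangular (n p : ℕ) : Type := (unitriangularSubmonoid n p)ˣ

namespace Unitriangular

variable {n p : ℕ}

instance : Group (Unitriangular n p) := inferInstanceAs (Group (unitriangularSubmonoid n p)ˣ)

instance : TopologicalSpace (Unitriangular n p) := ⊥

instance : DiscreteTopology (Unitriangular n p) := ⟨rfl⟩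

instance [Fact p.Prime] : Finite (Unitriangular n p) :=
  inferInstanceAs (Finite (unitriangularSubmonoid n p)ˣ)

/-- The underlying matrix. -/
def toMatrix : Unitriangular n p →* Matrix (Fin n) (Fin n) (ZMod p) :=
  (unitriangularSubmonoid n p).subtype.comp (Units.coeHom _)

theorem toMatrix_injective : Function.Injective (toMatrix : Unitriangular n p → _) :=
  fun _ _ h => Units.ext (Subtype.ext h)

theorem offsetGE_sub_one (g : Unitriangular n p) : OffsetGE 1 (toMatrix g - 1) := g.1.2

theorem pow_eq_one_of_le [Fact p.Prime] {n k : ℕ} (hk : n + 1 ≤ p ^ k)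
    {A : Matrix (Fin (n + 1)) (Fin (n + 1)) (ZMod p)} (hA : OffsetGE 1 (A - 1)) :
    A ^ p ^ k = 1 := by
  conv_lhs => rw [← add_sub_cancel 1 A]
  rw [one_add_pow_of_eq_char_pow rfl, (hA.pow _).eq_zero (by omega), add_zero]

theorem le_prime_pow (p n : ℕ) [Fact p.Prime] : n ≤ p ^ n :=
  (Nat.lt_pow_self (Fact.out : p.Prime).one_lt).le

theorem isPGroup [Fact p.Prime] : IsPGroup p (Unitriangular (n + 1) p) := by
  refine fun g => ⟨n + 1, toMatrix_injective ?_⟩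
  rw [map_pow, map_one, pow_eq_one_of_le (le_prime_pow p _) (offsetGE_sub_one g)]

/-- The unitriangular matrix with a given strictly upper triangular part. -/
def mk [Fact p.Prime] (N : Matrix (Fin (n + 1)) (Fin (n + 1)) (ZMod p)) (hN : OffsetGE 1 N) :
    Unitriangular (n + 1) p :=
  -- Invertibility comes from finite order: `n + 1 ≤ p ^ (n + 1)` makes the `p ^ (n + 1)`-th power
  -- trivial.
  Units.ofPowEqOne (⟨1 + N, by change OffsetGE 1 (1 + N - 1); rwa [add_sub_cancel_left]⟩ :
    unitriangularSubmonoid (n + 1) p) (p ^ (n + 1))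
    (Subtype.ext (pow_eq_one_of_le (le_prime_pow p _) (by rwa [add_sub_cancel_left])))
    (pow_ne_zero _ (Fact.out : p.Prime).ne_zero)

theorem toMatrix_mk [Fact p.Prime] (N : Matrix (Fin (n + 1)) (Fin (n + 1)) (ZMod p))
    (hN : OffsetGE 1 N) : toMatrix (mk N hN) = 1 + N := rfl

/-- With its left-hand counterpart, this makes `corner` central. -/
theorem mul_eq_right_of_offsetGE {K : Matrix (Fin (n + 1)) (Fin (n + 1)) (ZMod p)}
    (hK : OffsetGE n K) (g : Unitriangular (n + 1) p) : K * toMatrix g = K := by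
  have h := hK.mul_eq_zero (offsetGE_sub_one g) le_rfl
  rwa [mul_sub, mul_one, sub_eq_zero] at h

theorem mul_eq_left_of_offsetGE {K : Matrix (Fin (n + 1)) (Fin (n + 1)) (ZMod p)}
    (hK : OffsetGE n K) (g : Unitriangular (n + 1) p) : toMatrix g * K = K := by
  have h := (offsetGE_sub_one g).mul_eq_zero hK (by omega)
  rwa [sub_mul, one_mul, sub_eq_zero] at h

/-- The subgroup of the unitriangular matrices that differ from the identity at most at the upper
right corner. -/
def corner (n p : ℕ) : Subgroup (Unitriangular (n + 1) p) where
  carrier := {g | OffsetGE n (toMatrix g - 1)}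
  one_mem' := by
    rw [Set.mem_ofPred_eq, map_one, sub_self]
    exact OffsetGE.zero
  mul_mem' {g h} hg hh := by
    have h1 : toMatrix (g * h) - 1 = (toMatrix g - 1) * toMatrix h + (toMatrix h - 1) := by
      rw [map_mul]
      noncomm_ring
    rw [Set.mem_ofPred_eq, h1, mul_eq_right_of_offsetGE hg]
    exact OffsetGE.add hg hh
  inv_mem' {g} hg := by
    have h1 : toMatrix g⁻¹ - 1 = -((toMatrix g - 1) * toMatrix g⁻¹) := by
      rw [sub_mul, ← map_mul, mul_inv_cancel, map_one]
      noncomm_ring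
    rw [Set.mem_ofPred_eq, h1, mul_eq_right_of_offsetGE hg]
    exact hg.neg

theorem mem_corner {g : Unitriangular (n + 1) p} :
    g ∈ corner n p ↔ OffsetGE n (toMatrix g - 1) := Iff.rfl

instance : (corner n p).Normal where
  conj_mem g hg h := by
    have h1 : toMatrix (h * g * h⁻¹) - 1 = toMatrix h * (toMatrix g - 1) * toMatrix h⁻¹ := by
      rw [mul_sub, sub_mul, mul_one, ← map_mul, ← map_mul, ← map_mul, mul_inv_cancel, map_one]
    rw [mem_corner, h1, mul_eq_left_of_offsetGE hg, mul_eq_right_of_offsetGE hg]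
    exact hg

theorem toMatrix_mul_apply_of_mem_corner (g : Unitriangular (n + 1) p)
    {z : Unitriangular (n + 1) p} (hz : z ∈ corner n p) {i j : Fin (n + 1)}
    (hij : (i, j) ≠ (0, Fin.last n)) : toMatrix (g * z) i j = toMatrix g i j := by
  have h : toMatrix (g * z) = toMatrix g + (toMatrix z - 1) := by
    rw [← mul_eq_left_of_offsetGE hz g, mul_sub, ← map_mul]
    noncomm_ring
  rw [h, Matrix.add_apply, hz i j, add_zero]
  by_contra hlt
  exact hij (Prod.ext (Fin.ext (by simp only [Fin.val_zero]; omega))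
    (Fin.ext (by simp only [Fin.val_last]; omega)))

theorem pow_mem_corner [Fact p.Prime] {f : ℕ} (hn : n = p ^ f) (g : Unitriangular (n + 1) p) :
    g ^ n ∈ corner n p := by
  have h : toMatrix g ^ n = 1 + (toMatrix g - 1) ^ n := by
    conv_lhs => rw [← add_sub_cancel 1 (toMatrix g)]
    exact one_add_pow_of_eq_char_pow hn _
  rw [mem_corner, map_pow, h, add_sub_cancel_left]
  exact ((offsetGE_sub_one g).pow n).mono (by omega)

/-- The product formula for the entries of unitriangular matrices. -/
theorem toMatrix_mul_apply (g h : Unitriangular n p) {i j : Fin n} (hij : i ≠ j) :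
    toMatrix (g * h) i j = toMatrix g i j + toMatrix h i j +
      ∑ l ∈ Finset.Ioo i j, toMatrix g i l * toMatrix h l j := by
  have h1 : toMatrix (g * h) = (toMatrix g - 1) + (toMatrix h - 1) + 1 +
      (toMatrix g - 1) * (toMatrix h - 1) := by
    rw [map_mul]
    noncomm_ring
  rw [h1, Matrix.add_apply, Matrix.add_apply, Matrix.add_apply, Matrix.sub_apply,
    Matrix.sub_apply, Matrix.one_apply_ne hij,
    (offsetGE_sub_one g).mul_apply_eq_sum_Ioo (offsetGE_sub_one h), sub_zero, sub_zero, add_zero]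
  congr 1
  refine Finset.sum_congr rfl fun l hl => ?_
  obtain ⟨hil, hlj⟩ := Finset.mem_Ioo.1 hl
  rw [Matrix.sub_apply, Matrix.sub_apply, Matrix.one_apply_ne hil.ne, Matrix.one_apply_ne hlj.ne,
    sub_zero, sub_zero]

/-- The entries on the first superdiagonal are additive. -/
def superdiagonal (i j : Fin n) (hij : j.val = i.val + 1) :
    Unitriangular n p →* Multiplicative (ZMod p) where
  toFun g := Multiplicative.ofAdd (-toMatrix g i j)
  map_one' := by
    rw [map_one, Matrix.one_apply_ne (by rintro rfl; omega), neg_zero]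
    rfl
  map_mul' g h := by
    rw [toMatrix_mul_apply g h (by rintro rfl; omega), Finset.sum_eq_zero, add_zero, neg_add]
    · rfl
    · intro l hl
      obtain ⟨hil, hlj⟩ := Finset.mem_Ioo.1 hl
      rw [Fin.lt_def] at hil hlj
      omega

end Unitriangular

end Unitriangular

/-! ## Approximation in pro-`p` completions -/

theorem proPLift_eq_of_proj_eq {p : ℕ} [Fact p.Prime] {H P : Type*} [Group H] [Group P] [Finite P]
    (hP : IsPGroup p P) (φ : H →* P) (N : PIndexSubgroup p H) (hN : N.toSubgroup ≤ φ.ker)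
    (x : proPCompletion p H) (h : H) (hx : x.1 N = PQuotient.proj N h) :
    proPLift hP φ x = φ h := by
  have h1 := x.2 N (kerPIndex hP φ) hN
  rw [hx] at h1
  change QuotientGroup.kerLift φ (x.1 (kerPIndex hP φ)) = φ h
  rw [← h1]
  rfl

/-- One element `h` of the abstract group approximates `x` for `φ` and, simultaneously, for every
`ψ` that factors through the image of `φ`. Identities between such maps can thus be checked on the
abstract group. -/
theorem exists_proPLift_eq {p : ℕ} [Fact p.Prime] {H P : Type*} [Group H] [Group P] [Finite P]
    (hP : IsPGroup p P) (φ : H →* P) (x : proPCompletion p H) :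
    ∃ h : H, proPLift hP φ x = φ h ∧ ∀ {Q : Type} [Group Q] [Finite Q] (hQ : IsPGroup p Q)
      (ψ : H →* Q), φ.ker ≤ ψ.ker → proPLift hQ ψ x = ψ h := by
  obtain ⟨h, hh⟩ := QuotientGroup.mk_surjective (x.1 (kerPIndex hP φ))
  exact ⟨h, proPLift_eq_of_proj_eq hP φ _ le_rfl x h hh.symm,
    fun hQ ψ hle => proPLift_eq_of_proj_eq hQ ψ (kerPIndex hP φ) hle x h hh.symm⟩

/-! ## The defining system -/

section Existence

open Unitriangular

variable {V : Type*} (p n : ℕ)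

open Classical in
/-- The values on the vertex `x` of the sequence `u^* + v^*, u^*, …, u^*, u^* + v^*`. -/
def endsValue (u v x : V) (i : ℕ) : ZMod p :=
  (if x = u then 1 else 0) + if i = 0 ∨ i + 1 = n then (if x = v then 1 else 0) else 0

/-- The matrix with the entries `-endsValue p n u v x i` on the first superdiagonal. -/
def vertexMatrix (u v x : V) : Matrix (Fin (n + 1)) (Fin (n + 1)) (ZMod p) :=
  fun i j => if j.val = i.val + 1 then -endsValue p n u v x i.val else 0

theorem offsetGE_vertexMatrix (u v x : V) : OffsetGE 1 (vertexMatrix p n u v x) :=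
  fun _ _ h => if_neg (by omega)

variable [Fact p.Prime]

/-- The unitriangular representation of the free group with the prescribed superdiagonals. -/
def vertexHom (u v : V) : FreeGroup V →* Unitriangular (n + 1) p :=
  FreeGroup.lift fun x => mk (vertexMatrix p n u v x) (offsetGE_vertexMatrix p n u v x)

/-- The extension of `vertexHom` to the free pro-`p` group. -/
def proVertexHom (u v : V) : FreeProP p V →* Unitriangular (n + 1) p :=
  proPLift isPGroup (vertexHom p n u v)

variable {p n}

theorem continuous_proVertexHom (u v : V) : Continuous (proVertexHom p n u v) :=
  continuous_proPLift _ _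

theorem proVertexHom_of (u v x : V) : proVertexHom p n u v (FreeProP.of p x) =
    mk (vertexMatrix p n u v x) (offsetGE_vertexMatrix p n u v x) := by
  rw [proVertexHom, FreeProP.of, proPLift_apply, vertexHom, FreeGroup.lift_apply_of]

theorem proVertexHom_of_eq_one {u v x : V} (hu : x ≠ u) (hv : x ≠ v) :
    proVertexHom p n u v (FreeProP.of p x) = 1 := by
  rw [proVertexHom_of]
  refine toMatrix_injective ?_
  rw [toMatrix_mk, map_one, add_eq_left]
  ext i j
  simp [vertexMatrix, endsValue, hu, hv]

/-- Adjacent vertices have commuting images, so an undirected relator maps to `1` and a directed one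
to the inverse of an `n`-th power. The corner subgroup is normal and closed, hence absorbs all
relations. -/
theorem proVertexHom_mem_corner {Γ : Digraph V} (hΓ : ∀ x, ¬ Γ.Adj x x) {f : ℕ} (hn : n = p ^ f)
    {u v : V} (huv : ¬ Γ.Adj u v) (hvu : ¬ Γ.Adj v u) {r : FreeProP p V}
    (hr : r ∈ raagRelations Γ p n) : proVertexHom p n u v r ∈ corner n p := by
  have hcomm : ∀ x y, Γ.Adj x y →
      Commute (proVertexHom p n u v (FreeProP.of p x)) (proVertexHom p n u v (FreeProP.of p y)) := by
    intro x y hxy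
    by_cases hx : x ≠ u ∧ x ≠ v
    · rw [proVertexHom_of_eq_one hx.1 hx.2]
      exact Commute.one_left _
    · by_cases hy : y ≠ u ∧ y ≠ v
      · rw [proVertexHom_of_eq_one hy.1 hy.2]
        exact Commute.one_right _
      · exfalso
        have hx' : x = u ∨ x = v := by tauto
        have hy' : y = u ∨ y = v := by tauto
        rcases hx' with rfl | rfl <;> rcases hy' with rfl | rfl
        · exact hΓ _ hxy
        · exact huv hxy
        · exact hvu hxy
        · exact hΓ _ hxy
  have hle : raagRelations Γ p n ≤ (corner n p).comap (proVertexHom p n u v) := by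
    refine Subgroup.topologicalClosure_minimal _ ?_ ?_
    · refine Subgroup.normalClosure_le_normal ?_
      rintro r ⟨x, y, ⟨hxy, -, rfl⟩ | ⟨hxy, -, rfl⟩⟩
      · change proVertexHom p n u v _ ∈ corner n p
        simp only [map_mul, map_inv]
        rw [(hcomm x y hxy).eq, mul_inv_cancel_right, mul_inv_cancel]
        exact one_mem _
      · change proVertexHom p n u v _ ∈ corner n p
        simp only [map_mul, map_inv, map_pow]
        rw [← (hcomm x y hxy).eq, mul_inv_cancel_right, mul_inv_cancel, one_mul]
        exact inv_mem (pow_mem_corner hn _)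
    · exact (isClosed_discrete (corner n p : Set (Unitriangular (n + 1) p))).preimage
        (continuous_proVertexHom u v)
  exact hle hr

theorem superdiagonal_vertexHom (u v : V) (i j : Fin (n + 1)) (hij : j.val = i.val + 1)
    (h : FreeGroup V) : -toMatrix (vertexHom p n u v h) i j =
      (FreeGroup.lift (fun x => Multiplicative.ofAdd (endsValue p n u v x i.val)) h).toAdd := by
  have h1 : (superdiagonal i j hij).comp (vertexHom p n u v) =
      FreeGroup.lift (fun x => Multiplicative.ofAdd (endsValue p n u v x i.val)) := by
    ext x
    have hne : i ≠ j := by rintro rfl; omega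
    simp [superdiagonal, vertexHom, toMatrix_mk, vertexMatrix, hij, hne]
  exact congrArg Multiplicative.toAdd (DFunLike.congr_fun h1 h)

open Classical in
theorem toAdd_lift_endsValue (u v : V) (i : ℕ) (h : FreeGroup V) :
    (FreeGroup.lift (fun x => Multiplicative.ofAdd (endsValue p n u v x i)) h).toAdd =
      (FreeGroup.lift (fun x => Multiplicative.ofAdd (if x = u then (1 : ZMod p) else 0)) h).toAdd +
        if i = 0 ∨ i + 1 = n then
          (FreeGroup.lift (fun x => Multiplicative.ofAdd (if x = v then (1 : ZMod p) else 0))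
            h).toAdd
        else 0 := by
  by_cases hi : i = 0 ∨ i + 1 = n
  · rw [if_pos hi, ← toAdd_mul, ← MonoidHom.mul_apply]
    congr 2
    ext x
    simp [endsValue, hi]
  · rw [if_neg hi, add_zero]
    simp [endsValue, hi]

theorem superdiagonal_proVertexHom (hn : 3 ≤ n) (u v : V) (i j : Fin (n + 1))
    (hij : j.val = i.val + 1) (x : FreeProP p V) :
    -toMatrix (proVertexHom p n u v x) i j = (freeVertexDual p u x).toAdd +
      if i.val = 0 ∨ i.val + 1 = n then (freeVertexDual p v x).toAdd else 0 := by
  classical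
  obtain ⟨h, hx, happrox⟩ := exists_proPLift_eq isPGroup (vertexHom p n u v) x
  have hker : ∀ (k : FreeGroup V), vertexHom p n u v k = 1 → ∀ i, i < n →
      (FreeGroup.lift (fun x => Multiplicative.ofAdd (if x = u then (1 : ZMod p) else 0)) k).toAdd +
        (if i = 0 ∨ i + 1 = n then
          (FreeGroup.lift (fun x => Multiplicative.ofAdd (if x = v then (1 : ZMod p) else 0))
            k).toAdd
        else 0) = 0 := by
    intro k hk i hi
    have hsd := superdiagonal_vertexHom (p := p) (n := n) u v ⟨i, by omega⟩ ⟨i + 1, by omega⟩ rfl k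
    rw [toAdd_lift_endsValue, hk, map_one, Matrix.one_apply_ne (by simp), neg_zero] at hsd
    exact hsd.symm
  -- The interior position `1` detects `u^*` alone; position `0` then recovers `v^*` from `u^* +
  -- v^*`.
  have hkeru : ∀ k, vertexHom p n u v k = 1 →
      FreeGroup.lift (fun x => Multiplicative.ofAdd (if x = u then (1 : ZMod p) else 0)) k = 1 := by
    intro k hk
    have h1 := hker k hk 1 (by omega)
    rw [if_neg (by omega), add_zero] at h1
    exact h1
  have hkerv : ∀ k, vertexHom p n u v k = 1 →
      FreeGroup.lift (fun x => Multiplicative.ofAdd (if x = v then (1 : ZMod p) else 0)) k = 1 := by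
    intro k hk
    have h1 := hker k hk 0 (by omega)
    rw [if_pos (by simp), hkeru k hk, toAdd_one, zero_add] at h1
    exact h1
  have hu : freeVertexDual p u x = _ := happrox (isPGroup_multiplicative_zmod p) _ hkeru
  have hv : freeVertexDual p v x = _ := happrox (isPGroup_multiplicative_zmod p) _ hkerv
  rw [hu, hv, ← toAdd_lift_endsValue, ← superdiagonal_vertexHom u v i j hij, ← hx]
  rfl

/-- The entry of `proVertexHom` as a cochain on the oriented RAAG, with sign reversed and with the
upper right corner replaced by `0`. -/
def vertexCochain {Γ : Digraph V} {u v : V}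
    (hR : ∀ r ∈ raagRelations Γ p n, proVertexHom p n u v r ∈ corner n p) (i j : Fin (n + 1)) :
    C(OrientedRAAG Γ p n, ZMod p) where
  toFun := Quotient.lift
    (fun x => if (i, j) = (0, Fin.last n) then 0 else -toMatrix (proVertexHom p n u v x) i j) <| by
      intro a b hab
      by_cases hij : (i, j) = (0, Fin.last n)
      · simp only [if_pos hij]
      · have hab' : a⁻¹ * b ∈ raagRelations Γ p n := QuotientGroup.leftRel_apply.1 hab
        have h := toMatrix_mul_apply_of_mem_corner (proVertexHom p n u v a) (hR _ hab') hij
        rw [← map_mul, mul_inv_cancel_left] at h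
        simp only [if_neg hij, h]
  continuous_toFun := by
    refine Continuous.quotient_lift ?_ _
    exact (continuous_of_discreteTopology (f := fun g : Unitriangular (n + 1) p =>
      if (i, j) = (0, Fin.last n) then 0 else -toMatrix g i j)).comp (continuous_proVertexHom u v)

theorem vertexCochain_mk {Γ : Digraph V} {u v : V}
    (hR : ∀ r ∈ raagRelations Γ p n, proVertexHom p n u v r ∈ corner n p) {i j : Fin (n + 1)}
    (hij : (i, j) ≠ (0, Fin.last n)) (x : FreeProP p V) :
    vertexCochain hR i j (QuotientGroup.mk x) = -toMatrix (proVertexHom p n u v x) i j :=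
  if_neg hij

/-- For the corner pair `(0, n)` too, the sum is, up to sign, the coboundary of a matrix entry on
the free pro-`p` group, although that entry need not descend to `G`. -/
theorem sum_cupOne_vertexCochain {Γ : Digraph V} {u v : V}
    (hR : ∀ r ∈ raagRelations Γ p n, proVertexHom p n u v r ∈ corner n p) {i j : Fin (n + 1)}
    (hij : i < j) (x y : FreeProP p V) :
    (∑ l ∈ Finset.Ioo i j, cupOne (vertexCochain hR i l) (vertexCochain hR l j))
      (QuotientGroup.mk x, QuotientGroup.mk y) =
      toMatrix (proVertexHom p n u v (x * y)) i j - toMatrix (proVertexHom p n u v x) i j -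
        toMatrix (proVertexHom p n u v y) i j := by
  rw [map_mul (proVertexHom p n u v), Unitriangular.toMatrix_mul_apply _ _ hij.ne,
    ContinuousMap.sum_apply]
  have h : ∀ l ∈ Finset.Ioo i j, cupOne (vertexCochain hR i l) (vertexCochain hR l j)
      (QuotientGroup.mk x, QuotientGroup.mk y) =
      toMatrix (proVertexHom p n u v x) i l * toMatrix (proVertexHom p n u v y) l j := by
    intro l hl
    obtain ⟨hil, hlj⟩ := Finset.mem_Ioo.1 hl
    have h1 : (i, l) ≠ (0, Fin.last n) := fun h =>
      absurd (Fin.le_last j) (not_le.2 ((Prod.mk.inj h).2 ▸ hlj))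
    have h2 : (l, j) ≠ (0, Fin.last n) := fun h =>
      absurd ((Prod.mk.inj h).1 ▸ hil) (Fin.not_lt_zero i)
    change vertexCochain hR i l (QuotientGroup.mk x) * vertexCochain hR l j (QuotientGroup.mk y) = _
    rw [vertexCochain_mk hR h1, vertexCochain_mk hR h2, neg_mul_neg]
  rw [Finset.sum_congr rfl h]
  ring

theorem masseyProduct_nonempty {Γ : Digraph V} (hΓ : ∀ x, ¬ Γ.Adj x x) {f : ℕ} (hnf : n = p ^ f)
    (hpn : p ∣ n) (hn : 3 ≤ n) {u v : V} (huv : ¬ Γ.Adj u v) (hvu : ¬ Γ.Adj v u) :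
    (masseyProduct (endsSequence n (vertexDual Γ hpn u + vertexDual Γ hpn v)
      (vertexDual Γ hpn u))).Nonempty := by
  have hR : ∀ r ∈ raagRelations Γ p n, proVertexHom p n u v r ∈ corner n p :=
    fun r hr => proVertexHom_mem_corner hΓ hnf huv hvu hr
  have hlast : (0 : Fin (n + 1)) < Fin.last n := by
    rw [Fin.lt_def, Fin.val_zero, Fin.val_last]
    omega
  have hz : ∑ l ∈ Finset.Ioo 0 (Fin.last n),
      cupOne (vertexCochain hR 0 l) (vertexCochain hR l (Fin.last n)) ∈
      ContZ2 p (OrientedRAAG Γ p n) := by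
    rw [LinearMap.mem_ker]
    ext ⟨a, b, c⟩
    obtain ⟨x, rfl⟩ := QuotientGroup.mk_surjective a
    obtain ⟨y, rfl⟩ := QuotientGroup.mk_surjective b
    obtain ⟨z, rfl⟩ := QuotientGroup.mk_surjective c
    -- The cocycle identity can be checked on lifts, where the sum is the coboundary of minus the
    -- corner entry.
    have hs := sum_cupOne_vertexCochain hR hlast
    generalize ∑ l ∈ Finset.Ioo 0 (Fin.last n),
      cupOne (vertexCochain hR 0 l) (vertexCochain hR l (Fin.last n)) = S at hs
    change S (QuotientGroup.mk y, QuotientGroup.mk z) -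
      S (QuotientGroup.mk (x * y), QuotientGroup.mk z) +
      S (QuotientGroup.mk x, QuotientGroup.mk (y * z)) -
      S (QuotientGroup.mk x, QuotientGroup.mk y) = 0
    rw [hs, hs, hs, hs, mul_assoc]
    ring
  refine ⟨_, vertexCochain hR, ⟨fun i => ?_, fun i j hij hne => ?_⟩, ⟨_, hz⟩, rfl, rfl⟩
  · ext a
    obtain ⟨x, rfl⟩ := QuotientGroup.mk_surjective a
    have hne : (i.castSucc, i.succ) ≠ (0, Fin.last n) := by
      intro h
      have h1 := congrArg Fin.val (Prod.mk.inj h).1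
      have h2 := congrArg Fin.val (Prod.mk.inj h).2
      simp at h1 h2
      omega
    rw [vertexCochain_mk hR hne, superdiagonal_proVertexHom hn u v _ _ (by simp), endsSequence]
    simp only [Fin.val_castSucc]
    split_ifs
    · rfl
    · rw [add_zero]
      rfl
  · ext ⟨a, b⟩
    obtain ⟨x, rfl⟩ := QuotientGroup.mk_surjective a
    obtain ⟨y, rfl⟩ := QuotientGroup.mk_surjective b
    rw [sum_cupOne_vertexCochain hR hij]
    change vertexCochain hR i j (QuotientGroup.mk y) -
      vertexCochain hR i j (QuotientGroup.mk (x * y)) +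
      vertexCochain hR i j (QuotientGroup.mk x) = _
    rw [vertexCochain_mk hR hne, vertexCochain_mk hR hne, vertexCochain_mk hR hne]
    ring

end Existence

end

theorem proposition6p1 {V : Type*} [Finite V] (Γ : Digraph V) (hΓ : ∀ x, ¬ Γ.Adj x x)
    (p f : ℕ) [Fact p.Prime] (hf : f ≠ 0) (hf2 : p = 2 → 2 ≤ f)
    (u v w : V) (huvw : IsNonCliqueSpecialTriple Γ u v w) :
    MasseyEssential (endsSequence (p ^ f)
      (vertexDual Γ (dvd_pow_self p hf) u + vertexDual Γ (dvd_pow_self p hf) v)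
      (vertexDual Γ (dvd_pow_self p hf) u)) := by
  have hp := (Fact.out : p.Prime).two_le
  -- For `p = 2` the condition `f ≥ 2` gives `p ^ f ≥ 4`; an interior position needs length at least
  -- `3`.
  have hn : 3 ≤ p ^ f := by
    rcases hp.eq_or_lt with h | h
    · have h4 := Nat.pow_le_pow_right (show 0 < 2 by omega) (hf2 h.symm)
      rw [← h]
      omega
    · exact le_trans h (Nat.le_self_pow hf p)
  exact ⟨masseyProduct_nonempty hΓ rfl _ hn huvw.not_adj_uv huvw.not_adj_vu,
    zero_notMem_masseyProduct_of_triple Γ rfl _ hn u v w huvw⟩
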